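/- **Setting.** A bandit instance is an action set $\mathcal A$ together with a (measurable) family $(P_a)_{a\in\mathcal A}$ of probability measures on $[0,1]$ (bounded costs). Write $\eta(a)=\int y\,P_a(dy)$ and let $a_\star\in\arg\min_{a\in\mathcal A}\eta(a)$. In rounds $t=1,2,\dots,n$ a learner selects $A_t\in\mathcal A$ and receives a cost $Y_t$ whose conditional law given $A_1,Y_1,\dots,A_{t-1},Y_{t-1},A_t$ is $P_{A_t}$. The regret is $R_n=\sum_{t=1}^n\big(\eta(A_t)-\eta(a_\star)\big)$. Let $\mathcal F$ be a set of (measurable) functions $\mathcal A\to[0,1]$ with $\eta\in\mathcal F$ (realisability), and $\ell:[0,1]\times[0,1]\to\mathbb R$ a (measurable) loss. For $f\in\mathcal F$ put $\phi_f(y,a)=\ell(y,f(a))-\ell(y,\eta(a))$ and $\bar\phi_f(a)=\int\phi_f(y,a)\,P_a(dy)$; for $\mathcal F'\subset\mathcal F$ let $\Phi(\mathcal F')=\{\phi_f:f\in\mathcal F'\}$ and $\bar\Phi(\mathcal F')=\{\bar\phi_f: f\in\mathcal F'\}$. Let $\Delta(p,q)=(p-q)^2/(p+q)$ with $\Delta(0,0)=0$.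 Assume that there are constants $b,c,\gamma>0$ such that for all $(f,a)\in\mathcal F\times\mathcal A$ and $Y\sim P_a$: $$|\phi_f(Y,a)|\le b\ \text{ a.s.},\qquad \operatorname{Var}\phi_f(Y,a)\le c\,\bar\phi_f(a),\qquad \Delta(f(a),\eta(a))\le\gamma\,\bar\phi_f(a).$$ **$\ell$-UCB.** Given confidence widths $(\beta_t)$, in round $t$ let $$\mathcal F_t=\Big\{f\in\mathcal F:\ \sum_{i=1}^{t-1}\ell(Y_i,f(A_i))\le\inf_{\hat f\in\mathcal F}\sum_{i=1}^{t-1}\ell(Y_i,\hat f(A_i))+\beta_t\Big\};$$ the algorithm picks $(f_t,A_t)\in\mathcal F_t\times\mathcal A$ with $f_t(A_t)\le f(a)$ for all $(f,a)\in\mathcal F_t\times\mathcal A$, and plays $A_t$. **Eluder dimension.** For a set $\Psi$ of real functions on a set $\mathcal Z$, a point $x$ is $\epsilon$-independent of $z_1,\dots,z_k$ if some $\psi\in\Psi$ has $\sum_{j\le k}|\psi(z_j)|\le\epsilon$ and $|\psi(x)|>\epsilon$. A finite sequence is an $\epsilon$-eluder sequence if each of its elements is $\epsilon$-independent of its predecessors.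 The $\epsilon$-eluder dimension of $\Psi$ is the length of the longest $\omega$-eluder sequence for any $\omega\ge\epsilon$. **Theorem (regret bound for $\ell$-UCB in bandits).** Let $\delta\in(0,1)$ and $n\ge1$ be an integer. Let $N_n$ be the $1/n$-covering number of $\Phi(\mathcal F)$ (with centres in $\Phi(\mathcal F)$) in the uniform metric on functions $[0,1]\times\mathcal A\to\mathbb R$, assumed finite so that the widths below are real numbers, and let $$\beta_t=\tfrac52+15(b+c)\log(N_nh_t/\delta),\qquad h_t=e+\log(1+t).$$ Suppose that a learner uses $\ell$-UCB with these widths for $n$ interactions with the bandit instance. Then there is an event of probability at least $1-\delta$ on which, for every $\mathcal F'\subset\mathcal F$, $$R_n\le 3\sqrt{n\,\eta(a_\star)\,\Gamma_n}+6\,\Gamma_n+\#\{t\le n: f_t\notin\mathcal F'\},\qquad \Gamma_n=\gamma\big(1+(d_n+1)b+4d_n\beta_n\log(1+nb)\big),$$ where $d_n$ is the $1/n$-eluder dimension of $\bar\Phi(\mathcal F')$ (if $d_n=\infty$, then $\Gamma_n=\infty$ and nothing is claimed). -/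

import Mathlib

open MeasureTheory ProbabilityTheory unitInterval
open scoped NNReal UniformConvergence

namespace LUCB

noncomputable section

/-- The mean cost `η(a) = ∫ y P_a(dy)` of the action `a`. The costs take values in `[0,1]`: the
bandit instance is a family `P` of probability measures on the unit interval `I`. -/
def meanCost {𝒜 : Type*} [MeasurableSpace 𝒜] (P : Kernel 𝒜 I) [IsMarkovKernel P] (a : 𝒜) : I :=
  ⟨∫ y, (y : ℝ) ∂(P a), integral_nonneg fun y => y.2.1, by
    have h : ‖∫ y, (y : ℝ) ∂(P a)‖ ≤ 1 * (P a).real Set.univ :=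
      norm_integral_le_of_norm_le_const (Filter.Eventually.of_forall fun y => by
        rw [Real.norm_eq_abs, abs_of_nonneg y.2.1]; exact y.2.2)
    simpa using (le_abs_self _).trans h⟩

/-- The excess loss `φ_f(y, a) = ℓ(y, f(a)) - ℓ(y, η(a))`. -/
def excessLoss {𝒜 : Type*} [MeasurableSpace 𝒜] (P : Kernel 𝒜 I) [IsMarkovKernel P]
    (ℓ : I → I → ℝ) (f : 𝒜 → I) (z : I × 𝒜) : ℝ :=
  ℓ z.1 (f z.2) - ℓ z.1 (meanCost P z.2)

/-- The expected excess loss `φ̄_f(a) = ∫ φ_f(y, a) P_a(dy)`. -/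
def expExcessLoss {𝒜 : Type*} [MeasurableSpace 𝒜] (P : Kernel 𝒜 I) [IsMarkovKernel P]
    (ℓ : I → I → ℝ) (f : 𝒜 → I) (a : 𝒜) : ℝ :=
  ∫ y, excessLoss P ℓ f (y, a) ∂(P a)

/-- The triangular discrimination `Δ(p, q) = (p - q)² / (p + q)`, with `Δ(0, 0) = 0`
(in Lean, division by zero gives zero). -/
def triangularDiscrimination (p q : I) : ℝ :=
  ((p : ℝ) - q) ^ 2 / ((p : ℝ) + q)

/-- The three conditions on the loss function, with constants `b, c, γ > 0`. -/
structure LossAssumption {𝒜 : Type*} [MeasurableSpace 𝒜] (P : Kernel 𝒜 I) [IsMarkovKernel P]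
    (ℓ : I → I → ℝ) (F : Set (𝒜 → I)) (b c γ : ℝ) : Prop where
  b_pos : 0 < b
  c_pos : 0 < c
  γ_pos : 0 < γ
  bounded_loss : ∀ f ∈ F, ∀ a, ∀ᵐ y ∂(P a), |excessLoss P ℓ f (y, a)| ≤ b
  variance_condition : ∀ f ∈ F, ∀ a,
    variance (fun y => excessLoss P ℓ f (y, a)) (P a) ≤ c * expExcessLoss P ℓ f a
  triangle_condition : ∀ f ∈ F, ∀ a,
    triangularDiscrimination (f a) (meanCost P a) ≤ γ * expExcessLoss P ℓ f a

/-- The `ε`-covering number of the excess loss class `Φ(F) = {φ_f : f ∈ F}` in the uniform metric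
`sup |φ - φ'|` on functions `[0,1] × 𝒜 → ℝ` (with centres in `Φ(F)`). The type `α →ᵤ β` is the
type of functions `α → β` with the uniform metric. -/
def excessLossCoveringNumber {𝒜 : Type*} [MeasurableSpace 𝒜] (P : Kernel 𝒜 I)
    [IsMarkovKernel P] (ℓ : I → I → ℝ) (F : Set (𝒜 → I)) (ε : ℝ≥0) : ℕ∞ :=
  Metric.coveringNumber ε ((fun f => UniformFun.ofFun (excessLoss P ℓ f)) '' F :
    Set (I × 𝒜 →ᵤ ℝ))

/-- `x` is `ε`-independent of `z₁, …, z_k` with respect to the function class `Ψ`. -/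
def EpsIndependent {Z : Type*} (Ψ : Set (Z → ℝ)) (ε : ℝ) {k : ℕ} (z : Fin k → Z) (x : Z) : Prop :=
  ∃ ψ ∈ Ψ, ∑ j, |ψ (z j)| ≤ ε ∧ ε < |ψ x|

/-- `z₁, …, z_k` is an `ε`-eluder sequence: every element is `ε`-independent of its
predecessors. -/
def IsEluderSequence {Z : Type*} (Ψ : Set (Z → ℝ)) (ε : ℝ) {k : ℕ} (z : Fin k → Z) : Prop :=
  ∀ i : Fin k, EpsIndependent Ψ ε (fun j : Fin i => z (Fin.castLT j (j.2.trans i.2))) (z i)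

/-- The (`ℓ₁`-)eluder dimension: the length of the longest `ω`-eluder sequence for any `ω ≥ ε`
(`⊤` if there are arbitrarily long ones). -/
def eluderDim {Z : Type*} (Ψ : Set (Z → ℝ)) (ε : ℝ) : ℕ∞ :=
  ⨆ (ω : ℝ) (_ : ε ≤ ω) (k : ℕ) (z : Fin k → Z) (_ : IsEluderSequence Ψ ω z), (k : ℕ∞)

/-- The σ-algebra generated by `A₁, Y₁, …, A_{t-1}, Y_{t-1}, A_t`. -/
@[reducible] def history {Ω 𝒜 : Type*} [MeasurableSpace 𝒜] (A : ℕ → Ω → 𝒜) (Y : ℕ → Ω → I) (t : ℕ) :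
    MeasurableSpace Ω :=
  (⨆ s ∈ Finset.Icc 1 t, MeasurableSpace.comap (A s) inferInstance) ⊔
    ⨆ s ∈ Finset.Ico 1 t, MeasurableSpace.comap (Y s) inferInstance

/-- `(A_t, Y_t)` for `t = 1, …, n` are the actions and costs of `n` interactions of some learner
with the bandit instance `P`: given the past and the current action `A_t`, the cost `Y_t` has
law `P_{A_t}`. -/
structure IsInteraction {Ω 𝒜 : Type*} [MeasurableSpace Ω] [MeasurableSpace 𝒜]
    (P : Kernel 𝒜 I) (μ : Measure Ω) (n : ℕ) (A : ℕ → Ω → 𝒜) (Y : ℕ → Ω → I) : Prop where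
  measurable_action : ∀ t ∈ Finset.Icc 1 n, Measurable (A t)
  measurable_cost : ∀ t ∈ Finset.Icc 1 n, Measurable (Y t)
  cost_law : ∀ t ∈ Finset.Icc 1 n, ∀ S : Set I, MeasurableSet S →
    μ[(Y t ⁻¹' S).indicator (fun _ => (1 : ℝ)) | history A Y t]
      =ᵐ[μ] fun ω => (P (A t ω)).real S

/-- The empirical risk `∑_{i=1}^{t-1} ℓ(y_i, f(a_i))`. -/
def empRisk {𝒜 : Type*} (ℓ : I → I → ℝ) (a : ℕ → 𝒜) (y : ℕ → I) (t : ℕ) (f : 𝒜 → I) : ℝ :=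
  ∑ i ∈ Finset.Ico 1 t, ℓ (y i) (f (a i))

/-- The confidence set `F_t`: the `f ∈ F` whose empirical risk is at most the infimum over `F` of
the empirical risk plus the width `β_t`. The infimum is taken in the extended reals. -/
def confSet {𝒜 : Type*} (ℓ : I → I → ℝ) (F : Set (𝒜 → I)) (β : ℕ → ℝ)
    (a : ℕ → 𝒜) (y : ℕ → I) (t : ℕ) : Set (𝒜 → I) :=
  {f | f ∈ F ∧
    (empRisk ℓ a y t f : EReal) ≤ (⨅ g ∈ F, (empRisk ℓ a y t g : EReal)) + (β t : EReal)}

theorem mem_confSet_iff {𝒜 : Type*} {ℓ : I → I → ℝ} {F : Set (𝒜 → I)} {β : ℕ → ℝ}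
    {a : ℕ → 𝒜} {y : ℕ → I} {t : ℕ} {f : 𝒜 → I} :
    f ∈ confSet ℓ F β a y t ↔ f ∈ F ∧ ∀ g ∈ F, empRisk ℓ a y t f ≤ empRisk ℓ a y t g + β t := by
  refine and_congr_right fun _ => ?_
  rw [← EReal.sub_le_iff_le_add (Or.inl (EReal.coe_ne_bot _)) (Or.inl (EReal.coe_ne_top _)),
    le_iInf₂_iff]
  refine forall₂_congr fun g _ => ?_
  rw [← EReal.coe_sub, EReal.coe_le_coe_iff, sub_le_iff_le_add]

/-- The pairs `(f_t, A_t)`, `t = 1, …, n`, are chosen by `ℓ`-UCB with widths `β`, on one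
trajectory: `f_t ∈ F_t` and `f_t(A_t) ≤ f(a)` for all `(f, a) ∈ F_t × 𝒜`. -/
def FollowsLUCB {𝒜 : Type*} (ℓ : I → I → ℝ) (F : Set (𝒜 → I)) (β : ℕ → ℝ) (n : ℕ)
    (f : ℕ → 𝒜 → I) (a : ℕ → 𝒜) (y : ℕ → I) : Prop :=
  ∀ t ∈ Finset.Icc 1 n, f t ∈ confSet ℓ F β a y t ∧
    ∀ g ∈ confSet ℓ F β a y t, ∀ a', f t (a t) ≤ g a'

/-- The confidence widths `β_t = 5/2 + 15 (b + c) log (N h_t / δ)`, `h_t = e + log (1 + t)`. -/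
def confWidth (b c δ : ℝ) (N : ℕ) (t : ℕ) : ℝ :=
  5 / 2 + 15 * (b + c) * Real.log (N * (Real.exp 1 + Real.log (1 + t)) / δ)

/-- `Γ_n = γ (1 + (d + 1) b + 4 d β_n log (1 + n b))`. -/
def Gam (b γ : ℝ) (d : ℕ) (β : ℕ → ℝ) (n : ℕ) : ℝ :=
  γ * (1 + (d + 1) * b + 4 * d * β n * Real.log (1 + n * b))

/-- The regret `R_n = ∑_{t=1}^n (η(a_t) - η(a_⋆))` along the actions `a`. -/
def regret {𝒜 : Type*} [MeasurableSpace 𝒜] (P : Kernel 𝒜 I) [IsMarkovKernel P] (aStar : 𝒜)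
    (n : ℕ) (a : ℕ → 𝒜) : ℝ :=
  ∑ t ∈ Finset.Icc 1 n, ((meanCost P (a t) : ℝ) - meanCost P aStar)

end

end LUCB

/-! For fixed `g ∈ F`, the variance condition makes the increments `φ̄_g(A_s)/2 - φ_g(Y_s, A_s)`,
scaled by `1/(2(b+c))`, have conditional exponential mean at most one (`lintegral_exp_le_one`).
Ville's inequality then bounds their partial sums for all `t ≤ n` at once. A union bound over `N`
centres and a total covering error of `3/2` extend this to all of `F`: half the cumulative `φ̄_f` is
at most the empirical excess risk of `f` over `η` plus `β_t`.

On this event `η` lies in every `F_t`, so `f_t(A_t) ≤ η(a⋆)`, and `∑_{s<t} φ̄_{f_t}(A_s) ≤ 4β_n`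
since `f_t ∈ F_t`. A pigeonhole argument (`exists_eluder_partition`) shows that `φ̄_{f_t}(A_t) > ω`
with `f_t ∈ F'` in at most `d(4β_n/ω + 1)` rounds; integrating over `ω` bounds the sum of these
values, and the triangle condition turns it into a bound `Γ` on the summed discriminations.

By Cauchy–Schwarz, with `η + f_t ≤ (η - η(a⋆)) + 2η(a⋆)` at `A_t`, the regret `R` of those rounds
satisfies `R² ≤ (R + 2nη(a⋆))Γ`. Each remaining round costs at most one. -/

namespace LUCB

/-! ### Conditional laws, Ville's inequality and Bernstein's inequality -/

theorem lintegral_eq_lintegral_kernel_of_condExp {Ω E B : Type*} {m m0 : MeasurableSpace Ω}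
    [MeasurableSpace E] [MeasurableSpace B] (hm : m ≤ m0) (μ : Measure Ω) [IsProbabilityMeasure μ]
    (κ : Kernel E B) [IsMarkovKernel κ] {X : Ω → E} {Y : Ω → B}
    (hX : Measurable[m] X) (hY : Measurable Y)
    (hcond : ∀ S : Set B, MeasurableSet S →
      μ[(Y ⁻¹' S).indicator (fun _ => (1 : ℝ)) | m] =ᵐ[μ] fun ω => (κ (X ω)).real S)
    {h : E × B → ENNReal} (hh : Measurable h) :
    ∫⁻ ω, h (X ω, Y ω) ∂μ = ∫⁻ ω, ∫⁻ y, h (X ω, y) ∂(κ (X ω)) ∂μ := by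
  have hX0 : Measurable X := hX.mono hm le_rfl
  have hlaw : μ.map (fun ω => (X ω, Y ω)) = (μ.map X) ⊗ₘ κ := by
    have : IsProbabilityMeasure (μ.map (fun ω => (X ω, Y ω))) :=
      Measure.isProbabilityMeasure_map (hX0.prodMk hY).aemeasurable
    have : IsProbabilityMeasure (μ.map X) := Measure.isProbabilityMeasure_map hX0.aemeasurable
    -- Rectangles determine the law. On `s ×ˢ t`, both sides come from integrating the conditional
    -- probability of `Y ∈ t` over `X ∈ s`, an event of `m`.
    refine Measure.ext_prod fun {s t} hs ht => ?_
    rw [Measure.compProd_apply_prod hs ht, Measure.map_apply (hX0.prodMk hY) (hs.prod ht),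
      setLIntegral_map hs (κ.measurable_coe ht) hX0]
    have hYt : MeasurableSet (Y ⁻¹' t) := hY ht
    have hint : Integrable ((Y ⁻¹' t).indicator (fun _ => (1 : ℝ))) μ :=
      (integrable_const 1).indicator hYt
    have h1 := setIntegral_condExp hm hint (hX hs)
    rw [setIntegral_congr_ae (g := fun ω => (κ (X ω)).real t) (hX0 hs)
      ((hcond t ht).mono fun ω hω _ => hω), setIntegral_indicator hYt] at h1
    simp only [integral_const, smul_eq_mul, mul_one, measureReal_restrict_apply_univ] at h1
    have h2 : ∫ ω in X ⁻¹' s, (κ (X ω)).real t ∂μ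
        = (∫⁻ ω in X ⁻¹' s, κ (X ω) t ∂μ).toReal :=
      integral_toReal ((κ.measurable_coe ht).comp hX0).aemeasurable
        (Filter.Eventually.of_forall fun ω => measure_lt_top _ _)
    have hfin : ∫⁻ ω in X ⁻¹' s, κ (X ω) t ∂μ ≠ ⊤ := by
      refine ne_of_lt (lt_of_le_of_lt (lintegral_mono fun ω => prob_le_one) ?_)
      simp
    rw [h2] at h1
    rw [Set.mk_preimage_prod]
    exact ((ENNReal.toReal_eq_toReal_iff' hfin (measure_ne_top _ _)).1 h1).symm
  rw [← lintegral_map hh (hX0.prodMk hY), hlaw, Measure.lintegral_compProd hh,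
    lintegral_map hh.lintegral_kernel_prod_right' hX0]

/-- The product `D 1 * ⋯ * D t`, stopped when it first reaches the level `C`. -/
noncomputable def stoppedProd {Ω : Type*} (D : ℕ → Ω → ENNReal) (C : ENNReal) : ℕ → Ω → ENNReal
  | 0 => fun _ => 1
  | t + 1 => fun ω => {ω | C ≤ stoppedProd D C t ω}.indicator (stoppedProd D C t) ω +
      {ω | C ≤ stoppedProd D C t ω}ᶜ.indicator (stoppedProd D C t) ω * D (t + 1) ω

/-- The σ-algebra is arbitrary so that it can be the ambient one or that of the past, for which the
product up to `t` is known before factor `t + 1`. -/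
theorem measurable_stoppedProd {Ω : Type*} {m : MeasurableSpace Ω} (D : ℕ → Ω → ENNReal)
    (C : ENNReal) (t : ℕ) (hD : ∀ s ∈ Finset.Icc 1 t, Measurable (D s)) :
    Measurable (stoppedProd D C t) := by
  induction t with
  | zero => exact measurable_const
  | succ t ih =>
    have hW := ih fun s hs => hD s (by simp only [Finset.mem_Icc] at hs ⊢; omega)
    have hK : MeasurableSet {ω | C ≤ stoppedProd D C t ω} := measurableSet_le measurable_const hW
    exact (hW.indicator hK).add ((hW.indicator hK.compl).mul (hD _ (by simp)))

/-- The value is frozen once it reaches `C`, so the final time alone records whether the level was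
ever reached. -/
theorem stoppedProd_eq_prod_or_le {Ω : Type*} (D : ℕ → Ω → ENNReal) (C : ENNReal) (ω : Ω) (t : ℕ) :
    ((∀ s < t, ∏ i ∈ Finset.Icc 1 s, D i ω < C) ∧
      stoppedProd D C t ω = ∏ i ∈ Finset.Icc 1 t, D i ω) ∨ C ≤ stoppedProd D C t ω := by
  induction t with
  | zero => simp [stoppedProd]
  | succ t ih =>
    by_cases hC : C ≤ stoppedProd D C t ω
    · right
      simp [stoppedProd, hC]
    · obtain ⟨h1, h2⟩ := ih.resolve_right hC
      left
      refine ⟨fun s hs => ?_, ?_⟩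
      · rcases Nat.lt_succ_iff_lt_or_eq.1 hs with h | rfl
        · exact h1 s h
        · rw [← h2]; exact not_le.1 hC
      · rw [Finset.prod_Icc_succ_top (by omega), ← h2]
        simp [stoppedProd, hC]

/-- Ville's inequality: a nonnegative process that is multiplied in each round by a factor of
conditional mean at most one reaches the level `C` with probability at most `1 / C`. -/
theorem mul_measure_exists_le_prod_le_one {Ω : Type*} {m0 : MeasurableSpace Ω} (μ : Measure Ω)
    [IsProbabilityMeasure μ] (n : ℕ) (m : ℕ → MeasurableSpace Ω) (hm : ∀ t ∈ Finset.Icc 1 n, m t ≤ m0)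
    (D : ℕ → Ω → ENNReal) (C : ENNReal)
    (hD0 : ∀ s ∈ Finset.Icc 1 n, Measurable (D s))
    (hD : ∀ t ∈ Finset.Icc 1 n, ∀ s ∈ Finset.Ico 1 t, Measurable[m t] (D s))
    (hstep : ∀ t ∈ Finset.Icc 1 n, ∀ G : Ω → ENNReal, Measurable[m t] G →
      ∫⁻ ω, G ω * D t ω ∂μ ≤ ∫⁻ ω, G ω ∂μ) :
    C * μ {ω | ∃ t ≤ n, C ≤ ∏ s ∈ Finset.Icc 1 t, D s ω} ≤ 1 := by
  have hint : ∀ t ≤ n, ∫⁻ ω, stoppedProd D C t ω ∂μ ≤ 1 := by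
    intro t
    induction t with
    | zero => simp [stoppedProd]
    | succ t ih =>
      intro ht
      have ht' : t + 1 ∈ Finset.Icc 1 n := by simp; omega
      have hW : Measurable[m (t + 1)] (stoppedProd D C t) :=
        @measurable_stoppedProd _ (m (t + 1)) D C t fun s hs =>
          hD _ ht' s (by simp only [Finset.mem_Icc, Finset.mem_Ico] at hs ⊢; omega)
      have hK : MeasurableSet[m (t + 1)] {ω | C ≤ stoppedProd D C t ω} := hW measurableSet_Ici
      have hW0 := hW.mono (hm _ ht') le_rfl
      have hK0 := hm _ ht' _ hK
      calc ∫⁻ ω, stoppedProd D C (t + 1) ω ∂μ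
          = ∫⁻ ω, {ω | C ≤ stoppedProd D C t ω}.indicator (stoppedProd D C t) ω ∂μ +
            ∫⁻ ω, {ω | C ≤ stoppedProd D C t ω}ᶜ.indicator (stoppedProd D C t) ω
              * D (t + 1) ω ∂μ := by
            simp only [stoppedProd]
            exact lintegral_add_left (hW0.indicator hK0) _
        -- Only the part not yet stopped receives the new factor.
        _ ≤ ∫⁻ ω, {ω | C ≤ stoppedProd D C t ω}.indicator (stoppedProd D C t) ω ∂μ +
            ∫⁻ ω, {ω | C ≤ stoppedProd D C t ω}ᶜ.indicator (stoppedProd D C t) ω ∂μ := by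
            exact add_le_add le_rfl (hstep _ ht' _ (hW.indicator hK.compl))
        _ = ∫⁻ ω, stoppedProd D C t ω ∂μ := by
            rw [← lintegral_add_left (hW0.indicator hK0)]
            refine lintegral_congr fun ω => ?_
            exact congrFun (Set.indicator_self_add_compl _ _) ω
        _ ≤ 1 := ih (by omega)
  refine le_trans ?_ (hint n le_rfl)
  refine le_trans (mul_le_mul_right (measure_mono ?_) C) (mul_meas_ge_le_lintegral
    (measurable_stoppedProd D C n hD0) C)
  rintro ω ⟨t, ht, hC⟩
  rcases stoppedProd_eq_prod_or_le D C ω n with ⟨h1, h2⟩ | h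
  · rcases ht.lt_or_eq with h | rfl
    · exact absurd hC (not_le.2 (h1 t h))
    · show C ≤ _
      rw [h2]; exact hC
  · exact h

/-- Bernstein's inequality for one factor of the exponential supermartingale. -/
theorem lintegral_exp_le_one {B : Type*} [MeasurableSpace B] (ν : Measure B)
    [IsProbabilityMeasure ν] {φ : B → ℝ} (hφ : Measurable φ) {b c : ℝ} (hb : 0 < b) (hc : 0 < c)
    (hbound : ∀ᵐ y ∂ν, |φ y| ≤ b) (hvar : variance φ ν ≤ c * ∫ y, φ y ∂ν) :
    ∫⁻ y, ENNReal.ofReal (Real.exp ((2 * (b + c))⁻¹ * ((∫ y, φ y ∂ν) / 2 - φ y))) ∂ν ≤ 1 := by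
  set m := ∫ y, φ y ∂ν with hmdef
  set r := (2 * (b + c))⁻¹ with hr
  have hr0 : 0 < r := by positivity
  have hrbc : r * (2 * (b + c)) = 1 := inv_mul_cancel₀ (by positivity)
  have hL : MemLp φ 2 ν := MemLp.of_bound hφ.aestronglyMeasurable b hbound
  have hφi : Integrable φ ν := hL.integrable (by norm_num)
  have hm : |m| ≤ b := by
    have := norm_integral_le_of_norm_le_const (μ := ν) (f := φ) (C := b) hbound
    simpa using this
  have hm0 : 0 ≤ m := by
    have := (variance_nonneg φ ν).trans hvar
    exact nonneg_of_mul_nonneg_right this hc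
  have hvar' : ∫ y, (φ y - m) ^ 2 ∂ν ≤ c * m := by
    rwa [← variance_eq_integral hφ.aemeasurable]
  have hsq : Integrable (fun y => (φ y - m) ^ 2) ν := (hL.sub (memLp_const m)).integrable_sq
  -- This is `exp x ≤ 1 + x + x²` for `|x| ≤ 1` at `x = r(m - φ)`; the choice of `r` gives `|x| ≤ 1`
  -- since `|m - φ| ≤ 2b`.
  have hpt : ∀ᵐ y ∂ν, Real.exp (r * (m / 2 - φ y)) ≤
      Real.exp (-(r * m / 2)) * (1 + r * (m - φ y) + r ^ 2 * (φ y - m) ^ 2) := by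
    filter_upwards [hbound] with y hy
    have h1 : |r * (m - φ y)| ≤ 1 := by
      rw [abs_mul, abs_of_pos hr0]
      have h2 : |m - φ y| ≤ 2 * (b + c) := by
        have := abs_sub m (φ y)
        linarith
      calc r * |m - φ y| ≤ r * (2 * (b + c)) := by gcongr
        _ = 1 := hrbc
    have h3 := (le_abs_self _).trans (Real.abs_exp_sub_one_sub_id_le h1)
    have h4 : r * (m / 2 - φ y) = -(r * m / 2) + r * (m - φ y) := by ring
    rw [h4, Real.exp_add]
    gcongr
    nlinarith
  have hi : Integrable (fun y => Real.exp (-(r * m / 2)) *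
      (1 + r * (m - φ y) + r ^ 2 * (φ y - m) ^ 2)) ν :=
    ((((integrable_const 1).add (((integrable_const m).sub hφi).const_mul r))).add
      (hsq.const_mul (r ^ 2))).const_mul _
  have hval : ∫ y, Real.exp (-(r * m / 2)) *
      (1 + r * (m - φ y) + r ^ 2 * (φ y - m) ^ 2) ∂ν ≤ 1 := by
    rw [integral_const_mul]
    have h5 : ∫ y, (1 + r * (m - φ y) + r ^ 2 * (φ y - m) ^ 2) ∂ν
        = 1 + r ^ 2 * ∫ y, (φ y - m) ^ 2 ∂ν := by
      have hr1 : Integrable (fun y => r * (m - φ y)) ν :=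
        ((integrable_const m).sub hφi).const_mul r
      have hr2 : Integrable (fun y => 1 + r * (m - φ y)) ν := (integrable_const 1).add hr1
      rw [integral_add hr2 (hsq.const_mul (r ^ 2)), integral_add (integrable_const 1) hr1,
        integral_const_mul, integral_const_mul, integral_sub (integrable_const m) hφi]
      simp [← hmdef]
    rw [h5]
    -- The variance condition with `rc ≤ 1/2` makes the quadratic term small enough for the
    -- prefactor `exp(-rm/2)` to absorb.
    have h6 : r ^ 2 * ∫ y, (φ y - m) ^ 2 ∂ν ≤ r * m / 2 := by
      calc r ^ 2 * ∫ y, (φ y - m) ^ 2 ∂ν ≤ r ^ 2 * (c * m) := by gcongr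
        _ = r * m * (r * c) := by ring
        _ ≤ r * m * (1 / 2) := by
          gcongr
          nlinarith
        _ = r * m / 2 := by ring
    calc Real.exp (-(r * m / 2)) * (1 + r ^ 2 * ∫ y, (φ y - m) ^ 2 ∂ν)
        ≤ Real.exp (-(r * m / 2)) * Real.exp (r * m / 2) := by
          gcongr
          linarith [Real.add_one_le_exp (r * m / 2)]
      _ = 1 := by rw [← Real.exp_add]; simp
  have hnn : 0 ≤ᵐ[ν] fun y => Real.exp (-(r * m / 2)) *
      (1 + r * (m - φ y) + r ^ 2 * (φ y - m) ^ 2) :=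
    hpt.mono fun y hy => (Real.exp_pos _).le.trans hy
  calc _ ≤ ∫⁻ y, ENNReal.ofReal (Real.exp (-(r * m / 2)) *
        (1 + r * (m - φ y) + r ^ 2 * (φ y - m) ^ 2)) ∂ν :=
        lintegral_mono_ae (hpt.mono fun y hy => ENNReal.ofReal_le_ofReal hy)
    _ = ENNReal.ofReal (∫ y, Real.exp (-(r * m / 2)) *
        (1 + r * (m - φ y) + r ^ 2 * (φ y - m) ^ 2) ∂ν) :=
        (ofReal_integral_eq_lintegral_ofReal hi hnn).symm
    _ ≤ 1 := by rw [← ENNReal.ofReal_one]; exact ENNReal.ofReal_le_ofReal hval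

/-! ### Counting large values through the eluder dimension -/

theorem IsEluderSequence.natCast_le_eluderDim {Z : Type*} {Ψ : Set (Z → ℝ)} {ε ω : ℝ} (h : ε ≤ ω)
    {k : ℕ} {z : Fin k → Z} (hz : IsEluderSequence Ψ ω z) : (k : ℕ∞) ≤ eluderDim Ψ ε :=
  le_iSup₂_of_le ω h (le_iSup₂_of_le k z (le_iSup_of_le hz le_rfl))

/-- The points `z i`, `i ∈ S`, in increasing order of their indices form an eluder sequence. -/
def IsEluderFinset {Z : Type*} (Ψ : Set (Z → ℝ)) (ε : ℝ) (z : ℕ → Z) (S : Finset ℕ) : Prop :=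
  ∀ i ∈ S, ∃ ψ ∈ Ψ, ∑ j ∈ S with j < i, |ψ (z j)| ≤ ε ∧ ε < |ψ (z i)|

theorem IsEluderFinset.isEluderSequence {Z : Type*} {Ψ : Set (Z → ℝ)} {ε : ℝ} {z : ℕ → Z}
    {S : Finset ℕ} (h : IsEluderFinset Ψ ε z S) :
    IsEluderSequence Ψ ε (fun i => z (S.orderEmbOfFin rfl i)) := by
  intro i
  obtain ⟨ψ, hψ, h1, h2⟩ := h _ (S.orderEmbOfFin_mem rfl i)
  refine ⟨ψ, hψ, le_trans (le_of_eq ?_) h1, h2⟩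
  refine Finset.sum_bij (fun j _ => S.orderEmbOfFin rfl (Fin.castLT j (j.2.trans i.2))) ?_ ?_ ?_ ?_
  · intro j _
    simp only [Finset.mem_filter, S.orderEmbOfFin_mem, true_and, OrderEmbedding.lt_iff_lt]
    exact j.2
  · intro j _ k _ hjk
    have := (S.orderEmbOfFin rfl).injective hjk
    ext
    simpa [Fin.ext_iff] using this
  · intro s hs
    obtain ⟨hs, hsi⟩ := Finset.mem_filter.1 hs
    have : s ∈ Set.range (S.orderEmbOfFin rfl) := by rw [S.range_orderEmbOfFin]; exact hs
    obtain ⟨j, rfl⟩ := this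
    rw [OrderEmbedding.lt_iff_lt] at hsi
    exact ⟨⟨j, hsi⟩, Finset.mem_univ _, rfl⟩
  · intro j _
    rfl

/-- Distribution of the indices over `K` eluder sequences. -/
theorem exists_eluder_partition {Z : Type*} {Ψ : Set (Z → ℝ)} {ω : ℝ} {z : ℕ → Z}
    {ψ : ℕ → Z → ℝ} {K : ℕ} (T : Finset ℕ) (hψ : ∀ t ∈ T, ψ t ∈ Ψ)
    (hbig : ∀ t ∈ T, ω < |ψ t (z t)|)
    (hsum : ∀ t ∈ T, ∑ s ∈ T with s < t, |ψ t (z s)| ≤ K * ω) (hK : 0 < K) :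
    ∃ p : ℕ → Fin K, ∀ k, IsEluderFinset Ψ ω z {t ∈ T | p t = k} := by
  induction T using Finset.induction_on_max with
  | empty => exact ⟨fun _ => ⟨0, hK⟩, fun k i hi => by simp at hi⟩
  | insert a T ha ih =>
    have hfilt : ∀ t ∈ T, {s ∈ insert a T | s < t} = {s ∈ T | s < t} := by
      intro t ht
      rw [Finset.filter_insert, if_neg (ha t ht).not_gt]
    obtain ⟨p, hp⟩ := ih (fun t ht => hψ t (by simp [ht])) (fun t ht => hbig t (by simp [ht]))
      (fun t ht => by rw [← hfilt t ht]; exact hsum t (by simp [ht]))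
    have haT : a ∉ T := fun h => (ha a h).false
    -- Pigeonhole: the `K` class sums total at most `Kω`, so some class can receive `a`. As `a` is
    -- the largest index, it precedes no element already placed.
    have hk : ∃ k, ∑ s ∈ T with p s = k, |ψ a (z s)| ≤ ω := by
      by_contra! hcon
      have h1 := hsum a (by simp)
      have h2 : {s ∈ insert a T | s < a} = T := by
        rw [Finset.filter_insert, if_neg (lt_irrefl a), Finset.filter_true_of_mem ha]
      rw [h2, ← Finset.sum_fiberwise T p] at h1
      have : Nonempty (Fin K) := ⟨⟨0, hK⟩⟩
      have h3 : ∑ _k : Fin K, ω < ∑ k, ∑ s ∈ T with p s = k, |ψ a (z s)| :=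
        Finset.sum_lt_sum_of_nonempty Finset.univ_nonempty fun k _ => hcon k
      simp at h3
      linarith
    obtain ⟨k, hk⟩ := hk
    refine ⟨Function.update p a k, fun l => ?_⟩
    have hupd : ∀ t ∈ T, Function.update p a k t = p t := fun t ht =>
      Function.update_of_ne (ha t ht).ne _ _
    have hfT : {t ∈ T | Function.update p a k t = l} = {t ∈ T | p t = l} :=
      Finset.filter_congr fun t ht => by rw [hupd t ht]
    by_cases hkl : k = l
    · subst hkl
      rw [Finset.filter_insert, if_pos (by simp), hfT]
      intro i hi
      rcases Finset.mem_insert.1 hi with rfl | hi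
      · refine ⟨ψ i, hψ i (by simp), le_trans (le_of_eq ?_) hk, hbig i (by simp)⟩
        rw [Finset.filter_insert, if_neg (lt_irrefl i), Finset.filter_true_of_mem]
        exact fun t ht => ha t (Finset.mem_filter.1 ht).1
      · rw [Finset.filter_insert, if_neg (ha i (Finset.mem_filter.1 hi).1).not_gt]
        exact hp k i hi
    · rw [Finset.filter_insert, if_neg (by simpa using hkl), hfT]
      exact hp l

/-- With `⌈B/ω⌉` classes, each is an eluder sequence at a level at least `ε` and so has at most `d`
elements. -/
theorem card_le_of_eluderDim {Z : Type*} {Ψ : Set (Z → ℝ)} {ε ω B : ℝ} (hω : 0 < ω) (hεω : ε ≤ ω)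
    (hB : 0 < B) {d : ℕ} (hd : eluderDim Ψ ε = d) {z : ℕ → Z} {ψ : ℕ → Z → ℝ} (T : Finset ℕ)
    (hψ : ∀ t ∈ T, ψ t ∈ Ψ) (hbig : ∀ t ∈ T, ω < |ψ t (z t)|)
    (hsum : ∀ t ∈ T, ∑ s ∈ T with s < t, |ψ t (z s)| ≤ B) :
    (T.card : ℝ) ≤ d * (B / ω + 1) := by
  have hK : 0 < ⌈B / ω⌉₊ := Nat.ceil_pos.2 (by positivity)
  obtain ⟨p, hp⟩ := exists_eluder_partition (K := ⌈B / ω⌉₊) T hψ hbig (fun t ht => by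
    refine (hsum t ht).trans ?_
    rw [← div_le_iff₀ hω]
    exact Nat.le_ceil _) hK
  have hcard : T.card ≤ ∑ _k : Fin ⌈B / ω⌉₊, d := by
    rw [Finset.card_eq_sum_card_fiberwise (f := p) (t := Finset.univ) (by simp)]
    refine Finset.sum_le_sum fun k _ => ?_
    have := (hp k).isEluderSequence.natCast_le_eluderDim hεω
    rw [hd] at this
    exact_mod_cast this
  have h1 : (T.card : ℝ) ≤ ⌈B / ω⌉₊ * d := by
    have : T.card ≤ ⌈B / ω⌉₊ * d := by simpa using hcard
    exact_mod_cast this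
  have h2 : (⌈B / ω⌉₊ : ℝ) ≤ B / ω + 1 := (Nat.ceil_lt_add_one (by positivity)).le
  calc (T.card : ℝ) ≤ ⌈B / ω⌉₊ * d := h1
    _ ≤ (B / ω + 1) * d := by gcongr
    _ = _ := by ring

/-! ### From level counts to sums -/

theorem sub_le_integral_indicator {a b x : ℝ} (hab : a ≤ b) (hx : x ≤ b) :
    x ≤ a + ∫ w in a..b, (Set.Iio x).indicator (fun _ => (1 : ℝ)) w := by
  by_cases hax : a ≤ x
  · rw [intervalIntegral.integral_of_le hab, integral_indicator measurableSet_Iio,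
      Measure.restrict_restrict measurableSet_Iio]
    have : Set.Iio x ∩ Set.Ioc a b = Set.Ioo a x := by
      ext w; simp only [Set.mem_inter_iff, Set.mem_Iio, Set.mem_Ioc, Set.mem_Ioo]
      constructor
      · rintro ⟨h1, h2, h3⟩; exact ⟨h2, h1⟩
      · rintro ⟨h1, h2⟩; exact ⟨h2, h1, by linarith⟩
    rw [this]
    simp [hax]
  · have : 0 ≤ ∫ w in a..b, (Set.Iio x).indicator (fun _ => (1 : ℝ)) w :=
      intervalIntegral.integral_nonneg hab fun w _ =>
        Set.indicator_nonneg (fun _ _ => zero_le_one) w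
    linarith

/-- Summation over the levels of a family whose upper level sets have `O(1 / ω)` elements. -/
theorem sum_le_of_card_le {n : ℕ} (hn : 1 ≤ n) (T : Finset ℕ) (hT : T.card ≤ n) {x : ℕ → ℝ}
    {b B d : ℝ} (hb : 0 < b) (hB : 0 ≤ B) (hd : 0 ≤ d) (hxb : ∀ t ∈ T, x t ≤ b)
    (hcard : ∀ ω, 1 / (n : ℝ) ≤ ω → (({t ∈ T | ω < x t}.card : ℕ) : ℝ) ≤ d * (B / ω + 1)) :
    ∑ t ∈ T, x t ≤ 1 + d * b + d * B * Real.log (1 + n * b) := by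
  have hn0 : (0 : ℝ) < n := by exact_mod_cast hn
  have hlog : 0 ≤ Real.log (1 + n * b) := Real.log_nonneg (by nlinarith)
  have hTn : (T.card : ℝ) ≤ n := by exact_mod_cast hT
  rcases le_total b (1 / (n : ℝ)) with hbn | hbn
  · have h1 : ∑ t ∈ T, x t ≤ T.card * (1 / (n : ℝ)) := by
      rw [← nsmul_eq_mul]
      exact Finset.sum_le_card_nsmul _ _ _ fun t ht => (hxb t ht).trans hbn
    have h2 : T.card * (1 / (n : ℝ)) ≤ n * (1 / (n : ℝ)) := by gcongr
    rw [mul_one_div_cancel hn0.ne'] at h2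
    have : 0 ≤ d * b + d * B * Real.log (1 + n * b) := by positivity
    linarith
  · have ha : 0 < 1 / (n : ℝ) := by positivity
    have hI : ∀ t ∈ T, IntervalIntegrable
        (fun w => (Set.Iio (x t)).indicator (fun _ => (1 : ℝ)) w) volume (1 / (n : ℝ)) b :=
      fun t _ => 
        (intervalIntegrable_const (c := (1 : ℝ))).mono_fun
          ((measurable_const.indicator measurableSet_Iio).aestronglyMeasurable)
          (Filter.Eventually.of_forall fun w => norm_indicator_le_norm_self (fun _ => (1 : ℝ)) w)
    have h0 : (0 : ℝ) ∉ Set.uIcc (1 / (n : ℝ)) b := by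
      rw [Set.uIcc_of_le hbn]; exact fun h => absurd h.1 (not_le.2 ha)
    have hinv : IntervalIntegrable (fun w : ℝ => w⁻¹) volume (1 / (n : ℝ)) b :=
      intervalIntegral.intervalIntegrable_inv (fun w hw => by rintro rfl; exact h0 hw)
        continuousOn_id
    -- Levels below `1/n` contribute at most `n · (1/n) = 1`. Above, exchanging sum and integral
    -- leaves the level counts, and `dB/w` integrates to `dB log(nb)`.
    have h1 : ∑ t ∈ T, x t ≤ ∑ t ∈ T, (1 / (n : ℝ) +
        ∫ w in (1 / (n : ℝ))..b, (Set.Iio (x t)).indicator (fun _ => (1 : ℝ)) w) :=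
      Finset.sum_le_sum fun t ht => sub_le_integral_indicator hbn (hxb t ht)
    rw [Finset.sum_add_distrib, ← intervalIntegral.integral_finsetSum hI] at h1
    have h2 : ∫ w in (1 / (n : ℝ))..b, ∑ t ∈ T, (Set.Iio (x t)).indicator (fun _ => (1 : ℝ)) w
        ≤ ∫ w in (1 / (n : ℝ))..b, (d * B * w⁻¹ + d) := by
      refine intervalIntegral.integral_mono_on hbn ?_ ((hinv.const_mul _).add
        intervalIntegrable_const) fun w hw => ?_
      · simpa only [Finset.sum_fn] using IntervalIntegrable.sum T hI
      · have := hcard w hw.1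
        have h3 : ∑ t ∈ T, (Set.Iio (x t)).indicator (fun _ => (1 : ℝ)) w
            = (({t ∈ T | w < x t}.card : ℕ) : ℝ) := by
          simp [Set.indicator_apply, Finset.sum_boole]
        rw [h3]
        calc _ ≤ _ := this
          _ = _ := by rw [div_eq_mul_inv]; ring
    rw [intervalIntegral.integral_add (hinv.const_mul _) intervalIntegrable_const,
      intervalIntegral.integral_const_mul, integral_inv h0, intervalIntegral.integral_const,
      smul_eq_mul] at h2
    have h4 : ∑ _t ∈ T, 1 / (n : ℝ) ≤ 1 := by
      rw [Finset.sum_const, nsmul_eq_mul, mul_one_div, div_le_one hn0]; exact hTn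
    have h5 : Real.log (b / (1 / (n : ℝ))) ≤ Real.log (1 + n * b) := by
      refine Real.log_le_log (by positivity) ?_
      rw [div_div_eq_mul_div, div_one]
      linarith
    have h6 : d * B * Real.log (b / (1 / (n : ℝ))) ≤ d * B * Real.log (1 + n * b) := by gcongr
    have h7 : (b - 1 / (n : ℝ)) * d ≤ d * b := by nlinarith
    linarith

/-! ### Excess losses and their finite covers -/

section

variable {𝒜 : Type*} [MeasurableSpace 𝒜] {P : Kernel 𝒜 I} [IsMarkovKernel P]
  {ℓ : I → I → ℝ} {F : Set (𝒜 → I)} {b c γ : ℝ}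

theorem measurable_excessLoss (hℓ : Measurable (Function.uncurry ℓ))
    (hη : Measurable (meanCost P)) {g : 𝒜 → I} (hg : Measurable g) :
    Measurable (excessLoss P ℓ g) :=
  (hℓ.comp (measurable_fst.prodMk (hg.comp measurable_snd))).sub
    (hℓ.comp (measurable_fst.prodMk (hη.comp measurable_snd)))

theorem measurable_expExcessLoss (hℓ : Measurable (Function.uncurry ℓ))
    (hη : Measurable (meanCost P)) {g : 𝒜 → I} (hg : Measurable g) :
    Measurable (expExcessLoss P ℓ g) := by
  have h : StronglyMeasurable (fun z : 𝒜 × I => excessLoss P ℓ g (z.2, z.1)) :=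
    ((measurable_excessLoss hℓ hη hg).comp measurable_swap).stronglyMeasurable
  exact (StronglyMeasurable.integral_kernel_prod_right' (κ := P) h).measurable

theorem LossAssumption.expExcessLoss_nonneg (h : LossAssumption P ℓ F b c γ) {g : 𝒜 → I}
    (hg : g ∈ F) (a : 𝒜) : 0 ≤ expExcessLoss P ℓ g a :=
  nonneg_of_mul_nonneg_right ((variance_nonneg _ _).trans (h.variance_condition g hg a)) h.c_pos

theorem LossAssumption.expExcessLoss_le (h : LossAssumption P ℓ F b c γ) {g : 𝒜 → I}
    (hg : g ∈ F) (a : 𝒜) : expExcessLoss P ℓ g a ≤ b := by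
  have := norm_integral_le_of_norm_le_const (μ := P a) (f := fun y => excessLoss P ℓ g (y, a))
    (C := b) (h.bounded_loss g hg a)
  simp only [probReal_univ, mul_one] at this
  exact (le_abs_self _).trans this

theorem LossAssumption.integrable_excessLoss (h : LossAssumption P ℓ F b c γ)
    (hℓ : Measurable (Function.uncurry ℓ)) (hη : Measurable (meanCost P)) {g : 𝒜 → I}
    (hg : g ∈ F) (hgm : Measurable g) (a : 𝒜) :
    Integrable (fun y => excessLoss P ℓ g (y, a)) (P a) :=
  Integrable.of_bound
    ((measurable_excessLoss hℓ hη hgm).comp measurable_prodMk_right).aestronglyMeasurable b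
    (h.bounded_loss g hg a)

/-- A finite covering number is attained. Its centres lie in `Φ(F)`, so they lift to members of `F`,
to which the loss assumptions apply. -/
theorem exists_finite_cover {n N : ℕ}
    (hN : excessLossCoveringNumber P ℓ F (1 / (n : ℝ≥0)) = (N : ℕ∞)) :
    ∃ G : Fin N → 𝒜 → I, (∀ i, G i ∈ F) ∧
      ∀ f ∈ F, ∃ i, ∀ z, |excessLoss P ℓ f z - excessLoss P ℓ (G i) z| ≤ 1 / (n : ℝ) := by
  have hne : excessLossCoveringNumber P ℓ F (1 / (n : ℝ≥0)) ≠ ⊤ := by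
    rw [hN]; exact ENat.natCast_ne_top N
  obtain ⟨C, hC, hCfin, hcov, hcard⟩ := Metric.exists_set_encard_eq_coveringNumber hne
  have hcard' : Nat.card C = N := by
    have : C.encard = N := hcard.trans hN
    rw [Nat.card_coe_set_eq, Set.ncard, this]
    rfl
  have : Finite C := hCfin
  let e := Finite.equivFinOfCardEq hcard'
  choose G hG hGe using fun i => hC (e.symm i).2
  refine ⟨G, hG, fun f hf => ?_⟩
  obtain ⟨ψ, hψ, hd⟩ := hcov (Set.mem_image_of_mem _ hf)
  refine ⟨e ⟨ψ, hψ⟩, fun z => ?_⟩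
  have h1 := hGe (e ⟨ψ, hψ⟩)
  simp only [Equiv.symm_apply_apply] at h1
  rw [← h1] at hd
  have h2 := UniformFun.edist_le.1 hd z
  simp only [UniformFun.toFun_ofFun] at h2
  rw [edist_nndist, ENNReal.coe_le_coe, ← NNReal.coe_le_coe, coe_nndist, Real.dist_eq] at h2
  simpa using h2

theorem abs_expExcessLoss_sub_le (h : LossAssumption P ℓ F b c γ)
    (hℓ : Measurable (Function.uncurry ℓ)) (hF : ∀ f ∈ F, Measurable f)
    (hη : Measurable (meanCost P)) {f g : 𝒜 → I} (hf : f ∈ F) (hg : g ∈ F) {ε : ℝ}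
    (hfg : ∀ z, |excessLoss P ℓ f z - excessLoss P ℓ g z| ≤ ε) (a : 𝒜) :
    |expExcessLoss P ℓ f a - expExcessLoss P ℓ g a| ≤ ε := by
  rw [expExcessLoss, expExcessLoss,
    ← integral_sub (h.integrable_excessLoss hℓ hη hf (hF f hf) a)
      (h.integrable_excessLoss hℓ hη hg (hF g hg) a)]
  have := norm_integral_le_of_norm_le_const (μ := P a)
    (f := fun y => excessLoss P ℓ f (y, a) - excessLoss P ℓ g (y, a)) (C := ε)
    (Filter.Eventually.of_forall fun y => hfg (y, a))
  simpa using this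

end

/-! ### Concentration along the interaction -/

section

variable {Ω 𝒜 : Type*} [MeasurableSpace 𝒜] {A : ℕ → Ω → 𝒜} {Y : ℕ → Ω → I}

theorem measurable_action_history {s t : ℕ} (hs : s ∈ Finset.Icc 1 t) :
    Measurable[history A Y t] (A s) :=
  Measurable.of_comap_le <| le_sup_of_le_left <|
    le_iSup₂ (f := fun s (_ : s ∈ Finset.Icc 1 t) => MeasurableSpace.comap (A s) inferInstance) s hs

theorem measurable_cost_history {s t : ℕ} (hs : s ∈ Finset.Ico 1 t) :
    Measurable[history A Y t] (Y s) :=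
  Measurable.of_comap_le <| le_sup_of_le_right <|
    le_iSup₂ (f := fun s (_ : s ∈ Finset.Ico 1 t) => MeasurableSpace.comap (Y s) inferInstance) s hs

theorem IsInteraction.history_le [m0 : MeasurableSpace Ω] {P : Kernel 𝒜 I} {μ : Measure Ω} {n : ℕ}
    (h : IsInteraction P μ n A Y) {t : ℕ} (ht : t ∈ Finset.Icc 1 n) : history A Y t ≤ m0 := by
  simp only [Finset.mem_Icc] at ht
  refine sup_le (iSup₂_le fun s hs => ?_) (iSup₂_le fun s hs => ?_)
  · exact (h.measurable_action s (by simp only [Finset.mem_Icc] at hs ⊢; omega)).comap_le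
  · exact (h.measurable_cost s (by
      simp only [Finset.mem_Icc, Finset.mem_Ico] at hs ⊢; omega)).comap_le

/-- The deviation `∑_{s=1}^t (φ̄_g(A_s) / 2 - φ_g(Y_s, A_s))`. -/
noncomputable def deviation (P : Kernel 𝒜 I) [IsMarkovKernel P] (ℓ : I → I → ℝ) (g : 𝒜 → I)
    (a : ℕ → 𝒜) (y : ℕ → I) (t : ℕ) : ℝ :=
  ∑ s ∈ Finset.Icc 1 t, (expExcessLoss P ℓ g (a s) / 2 - excessLoss P ℓ g (y s, a s))

theorem measure_exists_le_deviation {P : Kernel 𝒜 I} [IsMarkovKernel P]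
    {ℓ : I → I → ℝ} {F : Set (𝒜 → I)} {b c γ : ℝ} [MeasurableSpace Ω] {μ : Measure Ω}
    [IsProbabilityMeasure μ] {n : ℕ} (hint : IsInteraction P μ n A Y)
    (h : LossAssumption P ℓ F b c γ) (hℓ : Measurable (Function.uncurry ℓ))
    (hη : Measurable (meanCost P)) {g : 𝒜 → I} (hg : g ∈ F) (hgm : Measurable g)
    {x : ℝ} (hx : 0 < x) :
    μ {ω | ∃ t ≤ n, 2 * (b + c) * Real.log x ≤
      deviation P ℓ g (fun t => A t ω) (fun t => Y t ω) t} ≤ ENNReal.ofReal x⁻¹ := by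
  have hb := h.b_pos
  have hc := h.c_pos
  let D : 𝒜 × I → ENNReal := fun z => ENNReal.ofReal (Real.exp ((2 * (b + c))⁻¹ *
    (expExcessLoss P ℓ g z.1 / 2 - excessLoss P ℓ g (z.2, z.1))))
  have hD : Measurable D := by
    refine ENNReal.measurable_ofReal.comp (Real.measurable_exp.comp (Measurable.const_mul ?_ _))
    exact (((measurable_expExcessLoss hℓ hη hgm).comp measurable_fst).div_const 2).sub
      ((measurable_excessLoss hℓ hη hgm).comp measurable_swap)
  have hD1 : ∀ a, ∫⁻ y, D (a, y) ∂(P a) ≤ 1 := fun a =>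
    lintegral_exp_le_one (P a) ((measurable_excessLoss hℓ hη hgm).comp measurable_prodMk_right)
      hb hc (h.bounded_loss g hg a) (h.variance_condition g hg a)
  have hville := mul_measure_exists_le_prod_le_one μ n (history A Y)
    (fun t ht => hint.history_le ht) (fun s ω => D (A s ω, Y s ω)) (ENNReal.ofReal x)
    (fun s hs => hD.comp ((hint.measurable_action s hs).prodMk (hint.measurable_cost s hs)))
    (fun t _ s hs => hD.comp ((measurable_action_history (by
      simp only [Finset.mem_Icc, Finset.mem_Ico] at hs ⊢; omega)).prodMk
        (measurable_cost_history hs))) (fun t ht G hG => by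
      have hAt : Measurable[history A Y t] (A t) :=
        measurable_action_history (by simp only [Finset.mem_Icc] at ht ⊢; omega)
      -- The past weight `G` is carried as an extra coordinate of the conditioning variable, which
      -- the kernel ignores.
      have hlaw := lintegral_eq_lintegral_kernel_of_condExp (hint.history_le ht) μ
        (P.comap Prod.snd measurable_snd) (X := fun ω => (G ω, A t ω)) (hG.prodMk hAt)
        (hint.measurable_cost t ht) (fun S hS => hint.cost_law t ht S hS)
        (h := fun z : (ENNReal × 𝒜) × I => z.1.1 * D (z.1.2, z.2))
        ((measurable_fst.comp measurable_fst).mul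
          (hD.comp ((measurable_snd.comp measurable_fst).prodMk measurable_snd)))
      simp only [Kernel.comap_apply] at hlaw
      rw [hlaw]
      refine lintegral_mono fun ω => ?_
      rw [lintegral_const_mul (f := fun y => D (A t ω, y)) _ (hD.comp measurable_prodMk_left)]
      exact mul_le_of_le_one_right' (hD1 (A t ω)))
  have hset : {ω | ∃ t ≤ n, 2 * (b + c) * Real.log x ≤
      deviation P ℓ g (fun t => A t ω) (fun t => Y t ω) t} ⊆
      {ω | ∃ t ≤ n, ENNReal.ofReal x ≤ ∏ s ∈ Finset.Icc 1 t, D (A s ω, Y s ω)} := by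
    rintro ω ⟨t, ht, hle⟩
    refine ⟨t, ht, ?_⟩
    rw [← ENNReal.ofReal_prod_of_nonneg fun _ _ => (Real.exp_pos _).le, ← Real.exp_sum,
      ← Finset.mul_sum]
    refine ENNReal.ofReal_le_ofReal ?_
    rw [← Real.log_le_iff_le_exp hx, inv_mul_eq_div, le_div_iff₀ (by positivity), mul_comm]
    exact hle
  refine (measure_mono hset).trans ?_
  rw [ENNReal.ofReal_inv_of_pos hx, ENNReal.le_inv_iff_mul_le, mul_comm]
  exact hville

theorem measure_exists_le_deviation_cover {P : Kernel 𝒜 I} [IsMarkovKernel P]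
    {ℓ : I → I → ℝ} {F : Set (𝒜 → I)} {b c γ : ℝ} [MeasurableSpace Ω] {μ : Measure Ω}
    [IsProbabilityMeasure μ] {n : ℕ} (hint : IsInteraction P μ n A Y)
    (h : LossAssumption P ℓ F b c γ) (hℓ : Measurable (Function.uncurry ℓ))
    (hη : Measurable (meanCost P)) (hF : ∀ f ∈ F, Measurable f) {N : ℕ} (hN : 0 < N)
    {G : Fin N → 𝒜 → I} (hG : ∀ i, G i ∈ F) {δ : ℝ} (hδ : 0 < δ) :
    μ {ω | ∃ i, ∃ t ≤ n, 2 * (b + c) * Real.log (N / δ) ≤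
      deviation P ℓ (G i) (fun t => A t ω) (fun t => Y t ω) t} ≤ ENNReal.ofReal δ := by
  have hN' : (0 : ℝ) < N := by exact_mod_cast hN
  rw [Set.ofPred_exists]
  refine (measure_iUnion_fintype_le μ _).trans ?_
  -- Each centre fails with probability at most `δ/N`.
  refine (Finset.sum_le_sum fun i _ => measure_exists_le_deviation hint h hℓ hη (hG i)
    (hF _ (hG i)) (x := N / δ) (by positivity)).trans ?_
  rw [Finset.sum_const, Finset.card_univ, Fintype.card_fin, nsmul_eq_mul,
    ← ENNReal.ofReal_natCast, ← ENNReal.ofReal_mul hN'.le, inv_div, mul_div_cancel₀ _ hN'.ne']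

end

/-! ### Regret along a fixed trajectory -/

section

variable {𝒜 : Type*} [MeasurableSpace 𝒜] {P : Kernel 𝒜 I} [IsMarkovKernel P]
  {ℓ : I → I → ℝ} {F : Set (𝒜 → I)} {b c γ : ℝ}

/-- Uniform deviation bound over `F` from the deviation bound over a finite cover. -/
theorem half_sum_expExcessLoss_le (h : LossAssumption P ℓ F b c γ)
    (hℓ : Measurable (Function.uncurry ℓ)) (hF : ∀ f ∈ F, Measurable f)
    (hη : Measurable (meanCost P)) {n N : ℕ} (hn : 1 ≤ n) {G : Fin N → 𝒜 → I}
    (hG : ∀ i, G i ∈ F)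
    (hcov : ∀ f ∈ F, ∃ i, ∀ z, |excessLoss P ℓ f z - excessLoss P ℓ (G i) z| ≤ 1 / (n : ℝ))
    {a : ℕ → 𝒜} {y : ℕ → I} {L : ℝ} (hdev : ∀ i, ∀ t ≤ n, deviation P ℓ (G i) a y t ≤ L)
    {f : 𝒜 → I} (hf : f ∈ F) {t : ℕ} (ht1 : 1 ≤ t) (ht : t ≤ n) :
    (∑ s ∈ Finset.Ico 1 t, expExcessLoss P ℓ f (a s)) / 2 ≤
      ∑ s ∈ Finset.Ico 1 t, excessLoss P ℓ f (y s, a s) + (3 / 2 + L) := by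
  obtain ⟨i, hi⟩ := hcov f hf
  have hn0 : (0 : ℝ) < n := by exact_mod_cast hn
  have hIco : Finset.Icc 1 (t - 1) = Finset.Ico 1 t := by
    ext s; simp only [Finset.mem_Icc, Finset.mem_Ico]; omega
  have h1 := hdev i (t - 1) (by omega)
  rw [deviation, hIco] at h1
  -- Passing to the centre costs `1/(2n)` for the halved expectation and `1/n` for the loss.
  have h2 : ∑ s ∈ Finset.Ico 1 t, (expExcessLoss P ℓ f (a s) / 2 - excessLoss P ℓ f (y s, a s)) ≤
      ∑ s ∈ Finset.Ico 1 t, ((expExcessLoss P ℓ (G i) (a s) / 2 -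
        excessLoss P ℓ (G i) (y s, a s)) + 3 / 2 * (1 / (n : ℝ))) := by
    refine Finset.sum_le_sum fun s _ => ?_
    have h3 := abs_le.1 (hi (y s, a s))
    have h4 := abs_le.1 (abs_expExcessLoss_sub_le h hℓ hF hη hf (hG i) hi (a s))
    linarith [h3.1, h4.2]
  have h5 : ∑ _s ∈ Finset.Ico 1 t, 3 / 2 * (1 / (n : ℝ)) ≤ 3 / 2 := by
    rw [Finset.sum_const, nsmul_eq_mul, Nat.card_Ico]
    have : ((t - 1 : ℕ) : ℝ) ≤ n := by exact_mod_cast (by omega : t - 1 ≤ n)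
    calc ((t - 1 : ℕ) : ℝ) * (3 / 2 * (1 / (n : ℝ))) ≤ n * (3 / 2 * (1 / (n : ℝ))) := by gcongr
      _ = 3 / 2 := by field_simp
  rw [Finset.sum_add_distrib] at h2
  rw [Finset.sum_sub_distrib, ← Finset.sum_div] at h2
  linarith

theorem sum_excessLoss_eq (f : 𝒜 → I) (a : ℕ → 𝒜) (y : ℕ → I) (t : ℕ) :
    ∑ s ∈ Finset.Ico 1 t, excessLoss P ℓ f (y s, a s) =
      empRisk ℓ a y t f - empRisk ℓ a y t (meanCost P) := by
  simp only [excessLoss, empRisk, Finset.sum_sub_distrib]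

theorem confWidth_mono {δ : ℝ} (hδ : 0 < δ) (hbc : 0 < b + c) {N : ℕ} (hN : 0 < N) {s t : ℕ}
    (hst : s ≤ t) : confWidth b c δ N s ≤ confWidth b c δ N t := by
  have hN' : (0 : ℝ) < N := by exact_mod_cast hN
  have hst' : (s : ℝ) ≤ t := by exact_mod_cast hst
  have hs : 0 ≤ Real.log (1 + (s : ℝ)) := Real.log_nonneg (by linarith [s.cast_nonneg (α := ℝ)])
  have he := Real.exp_pos 1
  have hs0 : (0 : ℝ) ≤ s := s.cast_nonneg
  unfold confWidth
  gcongr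

/-- The width covers the discretisation error `3/2` and the Ville threshold, since `h_t ≥ e ≥ 1`. -/
theorem le_confWidth {δ : ℝ} (hδ : δ ∈ Set.Ioo (0 : ℝ) 1) (hbc : 0 < b + c) {N : ℕ} (hN : 0 < N)
    (t : ℕ) : 3 / 2 + 2 * (b + c) * Real.log (N / δ) ≤ confWidth b c δ N t := by
  have hN' : (1 : ℝ) ≤ N := by exact_mod_cast hN
  have hδ0 := hδ.1
  have hlog : 0 ≤ Real.log (N / δ) :=
    Real.log_nonneg (by rw [le_div_iff₀ hδ0]; linarith [hδ.2])
  have ht : 0 ≤ Real.log (1 + (t : ℝ)) := Real.log_nonneg (by linarith [t.cast_nonneg (α := ℝ)])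
  have h1 : Real.log (N / δ) ≤ Real.log (N * (Real.exp 1 + Real.log (1 + t)) / δ) := by
    have : 1 ≤ Real.exp 1 + Real.log (1 + t) := by linarith [Real.add_one_le_exp (1 : ℝ)]
    gcongr
    nlinarith
  unfold confWidth
  nlinarith [mul_le_mul_of_nonneg_left h1 hbc.le, mul_nonneg hbc.le hlog]

/-- Solving the quadratic gives `R ≤ Γ + √(2uΓ)`; the stated constants leave slack. -/
theorem le_of_sq_le {R Γ u : ℝ} (hΓ : 0 ≤ Γ) (hu : 0 ≤ u) (h : R ^ 2 ≤ (R + 2 * u) * Γ) :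
    R ≤ 3 * √(u * Γ) + 6 * Γ := by
  have hs := Real.sqrt_nonneg (u * Γ)
  have hss := Real.sq_sqrt (mul_nonneg hu hΓ)
  by_contra! hcon
  nlinarith [mul_nonneg hs hΓ]

theorem sq_sub_eq_mul_triangularDiscrimination (p q : I) :
    ((p : ℝ) - q) ^ 2 = ((p : ℝ) + q) * triangularDiscrimination q p := by
  unfold triangularDiscrimination
  have hp := p.2.1
  have hq := q.2.1
  rcases eq_or_ne ((p : ℝ) + q) 0 with h0 | h0
  · have h1 : (p : ℝ) = 0 := by linarith
    have h2 : (q : ℝ) = 0 := by linarith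
    simp [h1, h2]
  · rw [add_comm (q : ℝ), mul_div_cancel₀ _ h0]
    ring

open Classical in
/-- The sum of the expected excess losses of the played pairs `(f_t, A_t)` with `f_t ∈ F'`. -/
theorem sum_expExcessLoss_le (h : LossAssumption P ℓ F b c γ) {n : ℕ} (hn : 1 ≤ n)
    {a : ℕ → 𝒜} {f : ℕ → 𝒜 → I} {β : ℝ} (hβ : 0 < β)
    (hsum : ∀ t ∈ Finset.Icc 1 n, ∑ s ∈ Finset.Ico 1 t, expExcessLoss P ℓ (f t) (a s) ≤ 4 * β)
    {F' : Set (𝒜 → I)} (hF' : F' ⊆ F) {d : ℕ}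
    (hd : eluderDim (expExcessLoss P ℓ '' F') (1 / (n : ℝ)) = d) :
    ∑ t ∈ Finset.Icc 1 n with f t ∈ F', expExcessLoss P ℓ (f t) (a t) ≤
      1 + d * b + d * (4 * β) * Real.log (1 + n * b) := by
  have hn0 : (0 : ℝ) < n := by exact_mod_cast hn
  refine sum_le_of_card_le hn _ ((Finset.card_filter_le _ _).trans (by simp)) h.b_pos
    (by positivity) (Nat.cast_nonneg d) (fun t ht => ?_) fun ω hω => ?_
  · exact h.expExcessLoss_le (hF' (Finset.mem_filter.1 ht).2) _
  · have hmem : ∀ t ∈ {t ∈ {t ∈ Finset.Icc 1 n | f t ∈ F'} | ω < expExcessLoss P ℓ (f t) (a t)},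
        t ∈ Finset.Icc 1 n ∧ f t ∈ F' ∧ ω < expExcessLoss P ℓ (f t) (a t) := fun t ht => by
      rw [Finset.mem_filter, Finset.mem_filter] at ht
      exact ⟨ht.1.1, ht.1.2, ht.2⟩
    refine card_le_of_eluderDim (lt_of_lt_of_le (by positivity) hω) hω (by positivity) hd (z := a)
      (ψ := fun t => expExcessLoss P ℓ (f t)) _ (fun t ht => ?_) (fun t ht => ?_) fun t ht => ?_
    · exact Set.mem_image_of_mem _ (hmem t ht).2.1
    · exact (hmem t ht).2.2.trans_le (le_abs_self _)
    · obtain ⟨ht1, ht2, _⟩ := hmem t ht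
      refine le_trans ?_ (hsum t ht1)
      rw [Finset.sum_congr rfl fun s _ => abs_of_nonneg (h.expExcessLoss_nonneg (hF' ht2) (a s))]
      -- Nonnegativity of `φ̄` lets the sum over selected earlier rounds be enlarged to all earlier
      -- rounds.
      refine Finset.sum_le_sum_of_subset_of_nonneg (fun s hs => ?_)
        fun s _ _ => h.expExcessLoss_nonneg (hF' ht2) (a s)
      obtain ⟨hs1, hs2⟩ := Finset.mem_filter.1 hs
      exact Finset.mem_Ico.2 ⟨(Finset.mem_Icc.1 (hmem s hs1).1).1, hs2⟩

/-- The regret bound along a trajectory of optimistic choices. -/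
theorem regret_le (h : LossAssumption P ℓ F b c γ) {aStar : 𝒜}
    (haStar : ∀ a, meanCost P aStar ≤ meanCost P a) {n : ℕ} (hn : 1 ≤ n)
    {a : ℕ → 𝒜} {f : ℕ → 𝒜 → I} {β : ℕ → ℝ} (hβ : 0 < β n)
    (hsum : ∀ t ∈ Finset.Icc 1 n, ∑ s ∈ Finset.Ico 1 t, expExcessLoss P ℓ (f t) (a s) ≤ 4 * β n)
    (hopt : ∀ t ∈ Finset.Icc 1 n, f t (a t) ≤ meanCost P aStar)
    {F' : Set (𝒜 → I)} (hF' : F' ⊆ F) {d : ℕ}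
    (hd : eluderDim (expExcessLoss P ℓ '' F') (1 / (n : ℝ)) = d) :
    regret P aStar n a ≤ 3 * √(n * (meanCost P aStar : ℝ) * Gam b γ d β n) + 6 * Gam b γ d β n
      + ({t : ℕ | t ∈ Finset.Icc 1 n ∧ f t ∉ F'}.ncard : ℝ) := by
  classical
  have hn0 : (0 : ℝ) < n := by exact_mod_cast hn
  have hb := h.b_pos
  have hγ := h.γ_pos
  have hstar0 : (0 : ℝ) ≤ meanCost P aStar := (meanCost P aStar).2.1
  have hlog : 0 ≤ Real.log (1 + n * b) := Real.log_nonneg (by nlinarith)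
  have hΓ0 : 0 ≤ Gam b γ d β n := by unfold Gam; positivity
  set T := {t ∈ Finset.Icc 1 n | f t ∈ F'} with hT
  have hTn : (T.card : ℝ) ≤ n := by
    have : T.card ≤ n := (Finset.card_filter_le _ _).trans (by simp)
    exact_mod_cast this
  have hTmem : ∀ t ∈ T, t ∈ Finset.Icc 1 n ∧ f t ∈ F' := fun t ht => Finset.mem_filter.1 ht
  have hΔ : ∑ t ∈ T, triangularDiscrimination (f t (a t)) (meanCost P (a t)) ≤ Gam b γ d β n := by
    calc ∑ t ∈ T, triangularDiscrimination (f t (a t)) (meanCost P (a t))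
        ≤ ∑ t ∈ T, γ * expExcessLoss P ℓ (f t) (a t) := Finset.sum_le_sum fun t ht =>
          h.triangle_condition _ (hF' (hTmem t ht).2) _
      _ = γ * ∑ t ∈ T, expExcessLoss P ℓ (f t) (a t) := by rw [Finset.mul_sum]
      _ ≤ γ * (1 + d * b + d * (4 * β n) * Real.log (1 + n * b)) := by
          gcongr
          exact sum_expExcessLoss_le h hn hβ hsum hF' hd
      _ ≤ Gam b γ d β n := by
          unfold Gam
          refine mul_le_mul_of_nonneg_left ?_ hγ.le
          linarith
  have hCS := Finset.sum_sq_le_sum_mul_sum_of_sq_le_mul T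
    (r := fun t => (meanCost P (a t) : ℝ) - f t (a t))
    (f := fun t => (meanCost P (a t) : ℝ) + f t (a t))
    (g := fun t => triangularDiscrimination (f t (a t)) (meanCost P (a t)))
    (fun t _ => add_nonneg (meanCost P (a t)).2.1 (f t (a t)).2.1)
    (fun t _ => div_nonneg (sq_nonneg _) (add_nonneg (f t (a t)).2.1 (meanCost P (a t)).2.1))
    (fun t _ => (sq_sub_eq_mul_triangularDiscrimination _ _).le)
  have hopt' : ∀ t ∈ T, (f t (a t) : ℝ) ≤ meanCost P aStar := fun t ht =>
    hopt t (hTmem t ht).1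
  set R := ∑ t ∈ T, ((meanCost P (a t) : ℝ) - meanCost P aStar) with hR
  have hR0 : 0 ≤ R := Finset.sum_nonneg fun t _ => sub_nonneg.2 (haStar (a t))
  have hRS : R ≤ ∑ t ∈ T, ((meanCost P (a t) : ℝ) - f t (a t)) :=
    Finset.sum_le_sum fun t ht => by linarith [hopt' t ht]
  -- Optimism replaces `f_t(A_t)` by `η(a⋆)`, which produces the factor `nη(a⋆)` instead of the
  -- cruder `n`.
  have hsumadd : ∑ t ∈ T, ((meanCost P (a t) : ℝ) + f t (a t)) ≤
      R + 2 * (n * (meanCost P aStar : ℝ)) := by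
    calc ∑ t ∈ T, ((meanCost P (a t) : ℝ) + f t (a t))
        ≤ ∑ t ∈ T, (((meanCost P (a t) : ℝ) - meanCost P aStar) + 2 * meanCost P aStar) :=
          Finset.sum_le_sum fun t ht => by linarith [hopt' t ht]
      _ = R + T.card * (2 * meanCost P aStar) := by
          rw [Finset.sum_add_distrib, Finset.sum_const, nsmul_eq_mul]
      _ ≤ R + n * (2 * meanCost P aStar) := by gcongr
      _ = _ := by ring
  have hquad : R ^ 2 ≤ (R + 2 * (n * (meanCost P aStar : ℝ))) * Gam b γ d β n := by
    calc R ^ 2 ≤ (∑ t ∈ T, ((meanCost P (a t) : ℝ) - f t (a t))) ^ 2 := by gcongr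
      _ ≤ _ := hCS
      _ ≤ (R + 2 * (n * (meanCost P aStar : ℝ))) *
          ∑ t ∈ T, triangularDiscrimination (f t (a t)) (meanCost P (a t)) := by
          refine mul_le_mul_of_nonneg_right hsumadd (Finset.sum_nonneg fun t _ =>
            div_nonneg (sq_nonneg _) (add_nonneg (f t (a t)).2.1 (meanCost P (a t)).2.1))
      _ ≤ _ := by gcongr
  have hRle := le_of_sq_le hΓ0 (by positivity) hquad
  have hcount : {t : ℕ | t ∈ Finset.Icc 1 n ∧ f t ∉ F'}.ncard =
      {t ∈ Finset.Icc 1 n | f t ∉ F'}.card := by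
    rw [← Set.ncard_coe_finset]
    congr 1
    ext t
    simp
  have hrest : ∑ t ∈ Finset.Icc 1 n with f t ∉ F', ((meanCost P (a t) : ℝ) - meanCost P aStar) ≤
      {t ∈ Finset.Icc 1 n | f t ∉ F'}.card := by
    rw [← nsmul_one]
    exact Finset.sum_le_card_nsmul _ _ _ fun t _ => by linarith [(meanCost P (a t)).2.2]
  rw [regret, ← Finset.sum_filter_add_sum_filter_not _ (fun t => f t ∈ F'), hcount]
  exact add_le_add hRle hrest

end

end LUCB

/-! ### The good event and the conclusion -/

theorem mainTheorem2 {𝒜 : Type*} [MeasurableSpace 𝒜] (P : Kernel 𝒜 I) [IsMarkovKernel P]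
    (aStar : 𝒜) (haStar : ∀ a, LUCB.meanCost P aStar ≤ LUCB.meanCost P a)
    (F : Set (𝒜 → I)) (hF : ∀ f ∈ F, Measurable f)
    (ℓ : I → I → ℝ) (hℓ : Measurable (Function.uncurry ℓ))
    (hreal : LUCB.meanCost P ∈ F)
    (b c γ : ℝ) (hloss : LUCB.LossAssumption P ℓ F b c γ)
    (δ : ℝ) (hδ : δ ∈ Set.Ioo (0 : ℝ) 1) (n : ℕ) (hn : 1 ≤ n)
    (N : ℕ) (hN : LUCB.excessLossCoveringNumber P ℓ F (1 / (n : ℝ≥0)) = (N : ℕ∞))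
    {Ω : Type*} [MeasurableSpace Ω] (μ : Measure Ω) [IsProbabilityMeasure μ]
    (A : ℕ → Ω → 𝒜) (Y : ℕ → Ω → I) (f : ℕ → Ω → 𝒜 → I)
    (hint : LUCB.IsInteraction P μ n A Y)
    (halg : ∀ᵐ ω ∂μ, LUCB.FollowsLUCB ℓ F (LUCB.confWidth b c δ N) n
      (fun t => f t ω) (fun t => A t ω) (fun t => Y t ω)) :
    ∃ E : Set Ω, MeasurableSet E ∧ 1 - δ ≤ μ.real E ∧
      ∀ F' ⊆ F, ∀ d : ℕ, LUCB.eluderDim (LUCB.expExcessLoss P ℓ '' F') (1 / (n : ℝ)) = (d : ℕ∞) →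
        ∀ ω ∈ E,
          LUCB.regret P aStar n (fun t => A t ω) ≤
            3 * √(n * (LUCB.meanCost P aStar : ℝ) *
                LUCB.Gam b γ d (LUCB.confWidth b c δ N) n)
              + 6 * LUCB.Gam b γ d (LUCB.confWidth b c δ N) n
              + ({t : ℕ | t ∈ Finset.Icc 1 n ∧ f t ω ∉ F'}.ncard : ℝ) := by
  have hη : Measurable (LUCB.meanCost P) := hF _ hreal
  have hbc : 0 < b + c := add_pos hloss.b_pos hloss.c_pos
  obtain ⟨G, hG, hcov⟩ := LUCB.exists_finite_cover hN
  -- The class contains `η`, so a cover has at least one centre.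
  have hN0 : 0 < N := (hcov _ hreal).choose.pos
  set β := LUCB.confWidth b c δ N with hβdef
  let bad : Set Ω := {ω | ∃ i, ∃ t ≤ n, 2 * (b + c) * Real.log (N / δ) ≤
    LUCB.deviation P ℓ (G i) (fun t => A t ω) (fun t => Y t ω) t}
  let unlucky : Set Ω := {ω | ¬ LUCB.FollowsLUCB ℓ F β n
    (fun t => f t ω) (fun t => A t ω) (fun t => Y t ω)}
  have hbad : μ (bad ∪ unlucky) ≤ ENNReal.ofReal δ := by
    refine (measure_union_le _ _).trans ?_
    rw [show μ unlucky = 0 from ae_iff.1 halg, add_zero]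
    exact LUCB.measure_exists_le_deviation_cover hint hloss hℓ hη hF hN0 hG hδ.1
  -- The exceptional set need not be measurable, so its measurable hull, of equal measure, is
  -- removed. The event is fixed before `F'`.
  refine ⟨(toMeasurable μ (bad ∪ unlucky))ᶜ, (measurableSet_toMeasurable _ _).compl, ?_, ?_⟩
  · rw [probReal_compl_eq_one_sub (measurableSet_toMeasurable _ _)]
    have : μ.real (toMeasurable μ (bad ∪ unlucky)) ≤ δ := by
      rw [Measure.real, measure_toMeasurable]
      exact ENNReal.toReal_le_of_le_ofReal hδ.1.le hbad
    linarith
  intro F' hF' d hd ω hω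
  have hω' : ω ∉ bad ∪ unlucky := fun hmem => hω (subset_toMeasurable μ _ hmem)
  have hgood : ω ∉ bad := fun hmem => hω' (Or.inl hmem)
  have hfol : LUCB.FollowsLUCB ℓ F β n (fun t => f t ω) (fun t => A t ω) (fun t => Y t ω) :=
    not_not.1 fun hmem => hω' (Or.inr hmem)
  have hdev : ∀ i, ∀ t ≤ n, LUCB.deviation P ℓ (G i) (fun t => A t ω) (fun t => Y t ω) t ≤
      2 * (b + c) * Real.log (N / δ) := fun i t ht =>
    le_of_not_ge fun hle => hgood ⟨i, t, ht, hle⟩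
  have hconc : ∀ g ∈ F, ∀ t ∈ Finset.Icc 1 n,
      (∑ s ∈ Finset.Ico 1 t, LUCB.expExcessLoss P ℓ g (A s ω)) / 2 ≤
        LUCB.empRisk ℓ (fun t => A t ω) (fun t => Y t ω) t g -
          LUCB.empRisk ℓ (fun t => A t ω) (fun t => Y t ω) t (LUCB.meanCost P) + β t := by
    intro g hg t ht
    obtain ⟨ht1, ht2⟩ := Finset.mem_Icc.1 ht
    have h1 := LUCB.half_sum_expExcessLoss_le hloss hℓ hF hη hn hG hcov hdev hg ht1 ht2
    rw [LUCB.sum_excessLoss_eq] at h1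
    linarith [LUCB.le_confWidth (b := b) (c := c) hδ hbc hN0 t]
  have hηt : ∀ t ∈ Finset.Icc 1 n,
      LUCB.meanCost P ∈ LUCB.confSet ℓ F β (fun t => A t ω) (fun t => Y t ω) t := by
    intro t ht
    refine LUCB.mem_confSet_iff.2 ⟨hreal, fun g hg => ?_⟩
    have h1 := hconc g hg t ht
    have h2 : 0 ≤ ∑ s ∈ Finset.Ico 1 t, LUCB.expExcessLoss P ℓ g (A s ω) :=
      Finset.sum_nonneg fun s _ => hloss.expExcessLoss_nonneg hg _
    linarith
  have hβ0 : 0 < β n := by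
    have h1 := LUCB.le_confWidth (b := b) (c := c) hδ hbc hN0 n
    have h2 : 0 ≤ Real.log (N / δ) := Real.log_nonneg (by
      have : (1 : ℝ) ≤ N := by exact_mod_cast hN0
      rw [le_div_iff₀ hδ.1]; linarith [hδ.2])
    have h3 : 0 ≤ 2 * (b + c) * Real.log (N / δ) := by positivity
    linarith
  refine LUCB.regret_le hloss haStar hn (f := fun t => f t ω) hβ0 (fun t ht => ?_)
    (fun t ht => (hfol t ht).2 _ (hηt t ht) aStar) hF' hd
  obtain ⟨hft, hmin⟩ := LUCB.mem_confSet_iff.1 (hfol t ht).1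
  have h1 := hconc _ hft t ht
  -- Membership of `f_t` in `F_t` bounds its empirical excess over `η` by `β_t`; half the sum is
  -- then at most `2β_t ≤ 2β_n`.
  have h2 := hmin _ hreal
  have h3 : β t ≤ β n := LUCB.confWidth_mono hδ.1 hbc hN0 (Finset.mem_Icc.1 ht).2
  linarith
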